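/- Two clients $k=1,2$ each hold $n\ge 2$ i.i.d. training samples $S_k=(Z_{k,1},\dots,Z_{k,n})$, $Z_{k,i}=(X_{k,i},Y_{k,i})\in\mathbb R^d\times\{-1,+1\}$, drawn from a distribution $\mu_k$. Client $k$ applies an arbitrary, possibly stochastic, learning algorithm $P_{W_k\mid S_k}$ to its own data and outputs the weight vector $W_k\in\mathbb R^d$, $\|W_k\|\le 1$, of a linear classifier $f(x,w)=\langle x,w\rangle$ (SVM). The pairs $(S_1,W_1)$ and $(S_2,W_2)$ are independent, and the aggregated model is $\overline W=(W_1+W_2)/2$. For $\theta\in(0,1]$ the margin generalization error is $$\mathrm{gen}_\theta(S_{[2]},\overline W)=\frac12\sum_{k=1}^2\Big(\mathbb P_{(X,Y)\sim\mu_k}\big[Y\langle X,\overline W\rangle<0\big]-\frac1n\sum_{i=1}^n\mathbf 1\{Y_{k,i}\langle X_{k,i},\overline W\rangle<\theta\}\Big),$$ where the probability is over a fresh sample $(X,Y)$, with $\overline W$ fixed. There is an absolute constant $C>0$ such that the following holds for all $d$, all $n\ge2$, $\theta\in(0,1]$, $\rho>0$, $a_1,a_2\in\mathbb R^d$, all distributions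 $\mu_1^{\rm Het},\mu_2^{\rm Het}$ on $\mathbb R^d\times\{-1,+1\}$ with $\mathbb P_{(X,Y)\sim\mu_k^{\rm Het}}(\|X-a_k\|\le\rho)=1$ for $k=1,2$, and all learning algorithms as above. (Heterogeneous setting.) If client $k$ samples from $\mu_k=\mu_k^{\rm Het}$ for $k=1,2$, then $$\mathbb E[\mathrm{gen}_\theta(S_{[2]},\overline W)]\le C\sqrt{\frac{\left(\frac{\rho}{\theta}\right)^2\log\left(\max\left(3,\frac\theta\rho\right)\right)\log n+\frac12\left[\log\max\left(1,\frac{n\|a_1\|}{\theta}\right)+\log\max\left(1,\frac{n\|a_2\|}{\theta}\right)\right]}{n}}.$$ (Homogeneous setting.) If both clients sample from $\mu_1=\mu_2=(\mu_1^{\rm Het}+\mu_2^{\rm Het})/2$, then $$\mathbb E[\mathrm{gen}_\theta(S_{[2]},\overline W)]\le C\sqrt{\frac1n\left[\left(\frac{\rho+\|a_1-a_2\|}{\theta}\right)^2\log\left(\max\left(3,\frac{\theta}{\rho+\|a_1-a_2\|}\right)\right)\log n+\log\max\left(1,\frac{n\|a_1+a_2\|}{\theta}\right)\right]}.$$ 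-/

import Mathlib

open MeasureTheory ProbabilityTheory

noncomputable section

/-- Binary labels `-1` and `+1`. -/
abbrev Label : Type := ({-1, 1} : Set ℝ)

/-- Labelled data points `z = (x, y)` with feature `x ∈ ℝ^d` (Euclidean norm) and label `y = ±1`. -/
abbrev DataPoint (d : ℕ) : Type := EuclideanSpace ℝ (Fin d) × Label

/-- Hypotheses of a (normalized) linear SVM: weight vectors in the closed unit ball of `ℝ^d`. -/
abbrev Hypothesis (d : ℕ) : Type := Metric.closedBall (0 : EuclideanSpace ℝ (Fin d)) 1

/-- The 0-1 loss with margin `θ` of the linear classifier `x ↦ ⟪x, w⟫`: the indicator of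
`y * ⟪x, w⟫ < θ`. For `θ = 0` it is the usual 0-1 loss. -/
def marginLoss {d : ℕ} (θ : ℝ) (z : DataPoint d) (w : EuclideanSpace ℝ (Fin d)) : ℝ :=
  if (z.2 : ℝ) * inner ℝ z.1 w < θ then 1 else 0

/-- Population risk of `w` under `μ`, for the 0-1 loss (margin zero). -/
def populationRisk {d : ℕ} (μ : Measure (DataPoint d)) (w : EuclideanSpace ℝ (Fin d)) : ℝ :=
  ∫ z, marginLoss 0 z w ∂μ

/-- Empirical risk of `w` on the sample `s`, for the 0-1 loss with margin `θ`. -/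
def empiricalRisk {d n : ℕ} (θ : ℝ) (s : Fin n → DataPoint d)
    (w : EuclideanSpace ℝ (Fin d)) : ℝ :=
  (1 / (n : ℝ)) * ∑ i, marginLoss θ (s i) w

/-- The aggregated model: the arithmetic average of the clients' models. -/
def aggregate {K d : ℕ} (w : Fin K → Hypothesis d) : EuclideanSpace ℝ (Fin d) :=
  (1 / (K : ℝ)) • ∑ k, (w k : EuclideanSpace ℝ (Fin d))

/-- Margin generalization error of `w` for the data sets `s k` of the clients `k`, with data
distributions `μ k`: the average over the clients of population risk minus empirical margin risk. -/
def marginGen {K d n : ℕ} (θ : ℝ) (μ : Fin K → Measure (DataPoint d))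
    (s : Fin K → Fin n → DataPoint d) (w : EuclideanSpace ℝ (Fin d)) : ℝ :=
  (1 / (K : ℝ)) * ∑ k, (populationRisk (μ k) w - empiricalRisk θ (s k) w)

/-- Joint law of the data set and the model of one client: `n` i.i.d. samples from `μ`, and then a
model drawn from the (possibly stochastic) learning algorithm `A` applied to them. -/
def clientLaw {d n : ℕ} (μ : Measure (DataPoint d))
    (A : Kernel (Fin n → DataPoint d) (Hypothesis d)) :
    Measure ((Fin n → DataPoint d) × Hypothesis d) :=
  (Measure.pi fun _ : Fin n => μ) ⊗ₘ A

/-- Joint law of the data sets and the models of all clients, independent across the clients. -/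
def systemLaw {K d n : ℕ} (μ : Fin K → Measure (DataPoint d))
    (A : Fin K → Kernel (Fin n → DataPoint d) (Hypothesis d)) :
    Measure (Fin K → (Fin n → DataPoint d) × Hypothesis d) :=
  Measure.pi fun k => clientLaw (μ k) (A k)

/-- Expected margin generalization error of the aggregated model. -/
def expectedMarginGen {K d n : ℕ} (θ : ℝ) (μ : Fin K → Measure (DataPoint d))
    (A : Fin K → Kernel (Fin n → DataPoint d) (Hypothesis d)) : ℝ :=
  ∫ ω, marginGen θ μ (fun k => (ω k).1) (aggregate fun k => (ω k).2) ∂(systemLaw μ A)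

/-- The equal mixture `(μ₁ + μ₂) / 2` of two data distributions. -/
def equalMixture {d : ℕ} (μ : Fin 2 → Measure (DataPoint d)) : Measure (DataPoint d) :=
  (2⁻¹ : ENNReal) • (μ 0 + μ 1)

end

/-!
The bound holds uniformly over the unit ball, so neither the learning algorithms nor the averaging
of the models matter: for a client with data in the ball of radius `ρ` around `a`, the expected
supremum over `‖w‖ ≤ 1` of population risk minus empirical margin risk is `O((ρ / θ + 1) / √n)`,
without any logarithm.

To see this, squeeze a ramp loss between the 0-1 loss and the margin loss. Split the margin as
`y * (⟪x - a, w⟫ + ⟪a, w⟫)`. Since `|⟪x - a, w⟫| ≤ ρ`, the ramp is saturated as soon as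
`|⟪a, w⟫| ≥ ρ + θ`, so the intercept `⟪a, w⟫` may be clipped to `[-(ρ + θ), ρ + θ]` without changing
the loss (`rampLoss_eq_ramp_clippedMargin`). Symmetrization
(`integral_iSup_deviation_le_rademacher`) and the contraction principle
(`sum_signs_iSup_contraction`) reduce the claim to the Rademacher complexity of the clipped margins,
a linear class over a ball of radius `ρ` plus an intercept of size `ρ + θ`, which is at most
`(2 * ρ / θ + 1) * √n` (`sum_signs_iSup_clippedMargin_le`). Suprema are taken over a finite net of
the unit ball, at whose scale the ramp loss varies by `O(1 / √n)` (`exists_uniform_bound`).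

It remains to compare with the stated right-hand side. If `ρ + ‖a‖ < θ`, no data point is ever
classified with margin `θ`, the empirical margin risk is `1` and the generalization error is
nonpositive (`risk_sub_nonpos_of_norm_lt`). Otherwise either `ρ / θ` is at least `1 / 4` or
`n * ‖a‖ / θ` is at least `3 / 2`, and in both cases the complexity term dominates `(ρ / θ + 1) ^ 2`
(`add_one_sq_le_svmComplexity`). Concavity of the square root combines the clients. In the
homogeneous setting the mixture lives in the ball of radius `ρ + ‖a 0 - a 1‖` around the midpoint
of the centres.
-/

/-! ### Rademacher sums and the contraction principle -/

/-- The sign `±1` encoded by a Boolean. -/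
def rademacherSign (b : Bool) : ℝ := if b then 1 else -1

theorem abs_rademacherSign (b : Bool) : |rademacherSign b| = 1 := by
  cases b <;> simp [rademacherSign]

theorem sum_signs_succ {n : ℕ} (F : (Fin (n + 1) → Bool) → ℝ) :
    ∑ ε, F ε = ∑ ε : Fin n → Bool,
      (F (Fin.cons true ε) + F (Fin.cons false ε)) := by
  rw [← (Fin.consEquiv fun _ : Fin (n + 1) => Bool).sum_comp, Fintype.sum_prod_type,
    Fintype.sum_bool, ← Finset.sum_add_distrib]
  rfl

/-- Parallelogram identity over all sign patterns. -/
theorem sum_signs_norm_sq {E : Type*} [NormedAddCommGroup E] [InnerProductSpace ℝ E] {n : ℕ}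
    (u : E) (v : Fin n → E) :
    ∑ ε : Fin n → Bool, ‖u + ∑ j, rademacherSign (ε j) • v j‖ ^ 2
      = 2 ^ n * (‖u‖ ^ 2 + ∑ j, ‖v j‖ ^ 2) := by
  induction n generalizing u with
  | zero => simp
  | succ n ih =>
    rw [sum_signs_succ, Finset.sum_add_distrib]
    simp only [Fin.sum_univ_succ, Fin.cons_zero, Fin.cons_succ, ← add_assoc]
    rw [ih, ih]
    have h := parallelogram_law_with_norm ℝ u (v 0)
    simp only [rademacherSign, if_true, one_smul, Bool.false_eq_true, if_false, neg_smul,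
      ← sub_eq_add_neg]
    rw [pow_succ]
    linear_combination (2 : ℝ) ^ n * h

/-- The upper Khintchine inequality in a Hilbert space: the second moment of a Rademacher sum is
explicit and controls the first. -/
theorem sum_signs_norm_le {E : Type*} [NormedAddCommGroup E] [InnerProductSpace ℝ E] {n : ℕ}
    (v : Fin n → E) {r : ℝ} (hr : 0 ≤ r) (hv : ∀ j, ‖v j‖ ≤ r) :
    ∑ ε : Fin n → Bool, ‖∑ j, rademacherSign (ε j) • v j‖ ≤ 2 ^ n * (r * Real.sqrt n) := by
  have h := sum_signs_norm_sq (0 : E) v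
  simp only [zero_add, norm_zero] at h
  have hcs := sq_sum_le_card_mul_sum_sq (s := (Finset.univ : Finset (Fin n → Bool)))
    (f := fun ε => ‖∑ j, rademacherSign (ε j) • v j‖)
  rw [h] at hcs
  have hs : ∑ j, ‖v j‖ ^ 2 ≤ n * r ^ 2 := by
    calc ∑ j, ‖v j‖ ^ 2 ≤ ∑ _j : Fin n, r ^ 2 :=
          Finset.sum_le_sum fun j _ => pow_le_pow_left₀ (norm_nonneg _) (hv j) 2
      _ = n * r ^ 2 := by simp
  simp only [Finset.card_univ, Fintype.card_pi, Fintype.card_bool, Finset.prod_const,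
    Fintype.card_fin] at hcs
  refine abs_le_of_sq_le_sq' ?_ (by positivity) |>.2
  rw [mul_pow, mul_pow, Real.sq_sqrt (Nat.cast_nonneg n)]
  refine hcs.trans ?_
  push_cast
  have : (0 : ℝ) ≤ 2 ^ n * 2 ^ n := by positivity
  nlinarith [mul_le_mul_of_nonneg_left hs this]

/-- One step of the contraction principle: a pair of opposite signs. -/
theorem iSup_add_iSup_contraction {ι : Type*} [Finite ι] [Nonempty ι] (u v f : ι → ℝ)
    (hf : ∀ i j, |f i - f j| ≤ |v i - v j|) :
    (⨆ i, (u i + f i)) + (⨆ i, (u i - f i)) ≤ (⨆ i, (u i + v i)) + ⨆ i, (u i - v i) := by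
  obtain ⟨i, hi⟩ := exists_eq_ciSup_of_finite (f := fun i => u i + f i)
  obtain ⟨j, hj⟩ := exists_eq_ciSup_of_finite (f := fun i => u i - f i)
  rw [← hi, ← hj]
  have hp (k) : u k + v k ≤ ⨆ i, (u i + v i) :=
    le_ciSup (f := fun i => u i + v i) (Set.finite_range _).bddAbove k
  have hm (k) : u k - v k ≤ ⨆ i, (u i - v i) :=
    le_ciSup (f := fun i => u i - v i) (Set.finite_range _).bddAbove k
  have h := (le_abs_self _).trans (hf i j)
  rcases abs_cases (v i - v j) with h' | h'
  · linarith [hp i, hm j]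
  · linarith [hp j, hm i]

/-- The Ledoux–Talagrand contraction principle for a finite class with an additive offset `c`.
The offset is what makes the induction on the number of coordinates work. -/
theorem sum_signs_iSup_contraction {ι : Type*} [Finite ι] [Nonempty ι] {n : ℕ}
    (c : ι → ℝ) (t f : ι → Fin n → ℝ) (hf : ∀ i j k, |f i k - f j k| ≤ |t i k - t j k|) :
    ∑ ε : Fin n → Bool, ⨆ i, (c i + ∑ k, rademacherSign (ε k) * f i k)
      ≤ ∑ ε : Fin n → Bool, ⨆ i, (c i + ∑ k, rademacherSign (ε k) * t i k) := by
  induction n generalizing c with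
  | zero => simp
  | succ n ih =>
    rw [sum_signs_succ, sum_signs_succ]
    simp only [Fin.sum_univ_succ, Fin.cons_zero, Fin.cons_succ]
    simp only [rademacherSign, if_true, Bool.false_eq_true, if_false, one_mul, neg_one_mul]
    calc _ ≤ ∑ ε : Fin n → Bool,
          ((⨆ i, ((c i + t i 0) + ∑ k : Fin n, rademacherSign (ε k) * f i k.succ))
            + ⨆ i, ((c i - t i 0) + ∑ k : Fin n, rademacherSign (ε k) * f i k.succ)) := by
          refine Finset.sum_le_sum fun ε _ => ?_
          have := iSup_add_iSup_contraction
            (fun i => c i + ∑ k : Fin n, rademacherSign (ε k) * f i k.succ)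
            (fun i => t i 0) (fun i => f i 0) fun i j => hf i j 0
          refine (le_of_eq ?_).trans (this.trans (le_of_eq ?_)) <;> congr 1 <;>
            refine iSup_congr fun i => ?_ <;> simp only [rademacherSign] <;> ring
      _ ≤ _ := by
          rw [Finset.sum_add_distrib, Finset.sum_add_distrib]
          refine (add_le_add
            (ih (fun i => c i + t i 0) (fun i k => t i k.succ) (fun i k => f i k.succ)
              fun i j k => hf i j k.succ)
            (ih (fun i => c i - t i 0) (fun i k => t i k.succ) (fun i k => f i k.succ)
              fun i j k => hf i j k.succ)).trans (le_of_eq ?_)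
          congr 1 <;> refine Finset.sum_congr rfl fun ε _ => iSup_congr fun i => ?_ <;>
            simp only [rademacherSign] <;> ring

/-! ### Symmetrization -/

theorem integrable_iSup_of_bound {Ω ι : Type*} [MeasurableSpace Ω] {μ : Measure Ω}
    [IsFiniteMeasure μ] [Finite ι] [Nonempty ι] {f : ι → Ω → ℝ} (hf : ∀ i, Measurable (f i))
    {C : ℝ} (hC : ∀ i ω, |f i ω| ≤ C) : Integrable (fun ω => ⨆ i, f i ω) μ := by
  refine Integrable.of_bound (Measurable.iSup hf).aestronglyMeasurable C
    (Filter.Eventually.of_forall fun ω => ?_)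
  obtain ⟨i, hi⟩ := exists_eq_ciSup_of_finite (f := fun i => f i ω)
  rw [← hi]
  exact hC i ω

theorem ciSup_add_le_add_ciSup {ι : Type*} [Finite ι] [Nonempty ι] (u v : ι → ℝ) :
    ⨆ i, (u i + v i) ≤ (⨆ i, u i) + ⨆ i, v i :=
  ciSup_le fun i => add_le_add (le_ciSup (Set.finite_range u).bddAbove i)
    (le_ciSup (Set.finite_range v).bddAbove i)

/-- Adjoining an independent ghost sample `p.2` to the sample `p.1`: by Jensen, the expected
supremum of the deviations from the mean is at most that of the deviations from the ghost sample. -/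
theorem integral_iSup_deviation_le_ghost {Z ι : Type*} [MeasurableSpace Z] (μ : Measure Z)
    [IsProbabilityMeasure μ] [Finite ι] [Nonempty ι] {n : ℕ} (g : ι → Z → ℝ)
    (hg : ∀ i, Measurable (g i)) (hg1 : ∀ i z, |g i z| ≤ 1) :
    ∫ s : Fin n → Z, ⨆ i, ∑ j, (∫ z, g i z ∂μ - g i (s j)) ∂(Measure.pi fun _ => μ)
      ≤ ∫ p : Fin n → Z × Z, ⨆ i, ∑ j, (g i (p j).2 - g i (p j).1)
          ∂(Measure.pi fun _ => μ.prod μ) := by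
  have hint (i) : Integrable (g i) μ :=
    Integrable.of_bound (hg i).aestronglyMeasurable 1 (Filter.Eventually.of_forall (hg1 i))
  have hmean (i) : |∫ z, g i z ∂μ| ≤ 1 := by
    have := norm_integral_le_of_norm_le_const (μ := μ) (f := g i) (C := 1)
      (Filter.Eventually.of_forall (hg1 i))
    simpa using this
  have hb {x y : Fin n → ℝ} (hx : ∀ j, |x j| ≤ 1) (hy : ∀ j, |y j| ≤ 1) :
      |∑ j, (x j - y j)| ≤ n * 2 := by
    refine (Finset.abs_sum_le_sum_abs _ _).trans ((Finset.sum_le_card_nsmul _ _ 2 fun j _ => ?_).trans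
      (by simp))
    exact (abs_sub _ _).trans (by linarith [hx j, hy j])
  let H : (Fin n → Z) × (Fin n → Z) → ℝ := fun q => ⨆ i, ∑ j, (g i (q.2 j) - g i (q.1 j))
  have hH : Integrable H ((Measure.pi fun _ => μ).prod (Measure.pi fun _ => μ)) :=
    integrable_iSup_of_bound (C := n * 2)
      (fun i => Finset.measurable_sum _ fun j _ =>
        ((hg i).comp ((measurable_pi_apply j).comp measurable_snd)).sub
          ((hg i).comp ((measurable_pi_apply j).comp measurable_fst)))
      fun i q => hb (fun j => hg1 i _) fun j => hg1 i _
  have hghost : ∫ p : Fin n → Z × Z, ⨆ i, ∑ j, (g i (p j).2 - g i (p j).1)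
          ∂(Measure.pi fun _ => μ.prod μ)
        = ∫ s : Fin n → Z, ∫ s' : Fin n → Z, H (s, s') ∂(Measure.pi fun _ => μ)
          ∂(Measure.pi fun _ => μ) := by
    rw [← integral_prod _ hH, ← (measurePreserving_arrowProdEquivProdArrow Z Z (Fin n)
      (fun _ => μ) fun _ => μ).integral_comp' H]
    rfl
  rw [hghost]
  refine integral_mono
    (integrable_iSup_of_bound (C := n * 2)
      (fun i => Finset.measurable_sum _ fun j _ =>
        measurable_const.sub ((hg i).comp (measurable_pi_apply j)))
      fun i s => hb (fun j => hmean i) fun j => hg1 i _) hH.integral_prod_left fun s => ?_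
  refine ciSup_le fun i => ?_
  have hev (j : Fin n) : Integrable (fun s' : Fin n → Z => g i (s' j)) (Measure.pi fun _ => μ) :=
    (measurePreserving_eval (fun _ : Fin n => μ) j).integrable_comp_of_integrable (hint i)
  have hdiff (j : Fin n) :
      Integrable (fun s' : Fin n → Z => g i (s' j) - g i (s j)) (Measure.pi fun _ => μ) :=
    (hev j).sub (integrable_const _)
  calc ∑ j, (∫ z, g i z ∂μ - g i (s j))
      = ∫ s' : Fin n → Z, ∑ j, (g i (s' j) - g i (s j)) ∂(Measure.pi fun _ => μ) := by
        rw [integral_finsetSum _ fun j _ => hdiff j]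
        refine Finset.sum_congr rfl fun j _ => ?_
        rw [integral_sub (hev j) (integrable_const _), integral_const, probReal_univ, one_smul]
        congr 1
        have he := measurePreserving_eval (fun _ : Fin n => μ) j
        conv_lhs => rw [← he.map_eq]
        rw [integral_map he.measurable.aemeasurable (hg i).aestronglyMeasurable]
    _ ≤ ∫ s' : Fin n → Z, H (s, s') ∂(Measure.pi fun _ => μ) := by
        refine integral_mono (integrable_finsetSum _ fun j _ => hdiff j)
          (integrable_iSup_of_bound (C := n * 2)
            (f := fun i (s' : Fin n → Z) => ∑ j, (g i (s' j) - g i (s j)))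
            (fun i => Finset.measurable_sum _ fun j _ =>
              ((hg i).comp (measurable_pi_apply j)).sub measurable_const)
            fun i q => hb (fun j => hg1 i _) fun j => hg1 i _) fun s' => ?_
        exact le_ciSup (f := fun i => ∑ j, (g i (s' j) - g i (s j)))
          (Set.finite_range _).bddAbove i

/-- Exchanging sample and ghost points wherever `ε j` is `false` preserves the joint law. -/
theorem measurePreserving_swap_of_signs {Z : Type*} [MeasurableSpace Z] (μ : Measure Z)
    [IsProbabilityMeasure μ] {n : ℕ} (ε : Fin n → Bool) :
    MeasurePreserving (fun (p : Fin n → Z × Z) j => if ε j then p j else (p j).swap)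
      (Measure.pi fun _ => μ.prod μ) (Measure.pi fun _ => μ.prod μ) := by
  refine measurePreserving_pi (fun _ => μ.prod μ) (fun _ => μ.prod μ)
    (f := fun j q => if ε j then q else q.swap) fun j => ?_
  cases ε j
  · simpa using! Measure.measurePreserving_swap (μ := μ) (ν := μ)
  · simpa using! MeasurePreserving.id (μ.prod μ)

/-- Symmetrization: an almost sure bound `R` on the averaged suprema of the Rademacher sums of the
classes `g` and `-g` bounds the expected supremum of the deviations from the mean by `2 * R`. -/
theorem integral_iSup_deviation_le_rademacher {Z ι : Type*} [MeasurableSpace Z] (μ : Measure Z)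
    [IsProbabilityMeasure μ] [Finite ι] [Nonempty ι] {n : ℕ} (g : ι → Z → ℝ)
    (hg : ∀ i, Measurable (g i)) (hg1 : ∀ i z, |g i z| ≤ 1) {R : ℝ}
    (hpos : ∀ᵐ s : Fin n → Z ∂(Measure.pi fun _ => μ),
      ∑ ε : Fin n → Bool, ⨆ i, ∑ j, rademacherSign (ε j) * g i (s j) ≤ 2 ^ n * R)
    (hneg : ∀ᵐ s : Fin n → Z ∂(Measure.pi fun _ => μ),
      ∑ ε : Fin n → Bool, ⨆ i, ∑ j, rademacherSign (ε j) * -g i (s j) ≤ 2 ^ n * R) :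
    ∫ s : Fin n → Z, ⨆ i, ∑ j, (∫ z, g i z ∂μ - g i (s j)) ∂(Measure.pi fun _ => μ) ≤ 2 * R := by
  refine (integral_iSup_deviation_le_ghost μ g hg hg1).trans ?_
  set P : Measure (Fin n → Z × Z) := Measure.pi fun _ => μ.prod μ with hP
  have hb (ε : Fin n → Bool) (i) (p : Fin n → Z × Z) :
      |∑ j, rademacherSign (ε j) * (g i (p j).2 - g i (p j).1)| ≤ n * 2 := by
    refine (Finset.abs_sum_le_sum_abs _ _).trans ((Finset.sum_le_card_nsmul _ _ 2 fun j _ => ?_).trans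
      (by simp))
    rw [abs_mul, abs_rademacherSign, one_mul]
    exact (abs_sub _ _).trans (by linarith [hg1 i (p j).1, hg1 i (p j).2])
  have hm (i) (j : Fin n) : Measurable fun p : Fin n → Z × Z => g i (p j).2 - g i (p j).1 :=
    ((hg i).comp (measurable_snd.comp (measurable_pi_apply j))).sub
      ((hg i).comp (measurable_fst.comp (measurable_pi_apply j)))
  have hsigned (ε : Fin n → Bool) :
      ∫ p, ⨆ i, ∑ j, (g i (p j).2 - g i (p j).1) ∂P
        = ∫ p, ⨆ i, ∑ j, rademacherSign (ε j) * (g i (p j).2 - g i (p j).1) ∂P := by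
    have hT := measurePreserving_swap_of_signs μ ε
    conv_lhs => rw [hP, ← hT.map_eq]
    rw [integral_map hT.measurable.aemeasurable (Measurable.iSup fun i =>
      Finset.measurable_sum _ fun j _ => hm i j).aestronglyMeasurable]
    refine integral_congr_ae (Filter.Eventually.of_forall fun p => ?_)
    refine iSup_congr fun i => Finset.sum_congr rfl fun j _ => ?_
    rcases hε : ε j <;> simp [rademacherSign, hε]
  have hfst : MeasurePreserving (fun (p : Fin n → Z × Z) j => (p j).1) P (Measure.pi fun _ => μ) :=
    measurePreserving_pi (fun _ => μ.prod μ) (fun _ => μ) fun _ => measurePreserving_fst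
  have hsnd : MeasurePreserving (fun (p : Fin n → Z × Z) j => (p j).2) P (Measure.pi fun _ => μ) :=
    measurePreserving_pi (fun _ => μ.prod μ) (fun _ => μ) fun _ => measurePreserving_snd
  have hint (ε : Fin n → Bool) :
      Integrable (fun p => ⨆ i, ∑ j, rademacherSign (ε j) * (g i (p j).2 - g i (p j).1)) P :=
    integrable_iSup_of_bound (C := n * 2)
      (fun i => Finset.measurable_sum _ fun j _ => (hm i j).const_mul _) (hb ε)
  have hsum : (2 : ℝ) ^ n * ∫ p, ⨆ i, ∑ j, (g i (p j).2 - g i (p j).1) ∂P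
      = ∫ p, ∑ ε : Fin n → Bool,
          ⨆ i, ∑ j, rademacherSign (ε j) * (g i (p j).2 - g i (p j).1) ∂P := by
    rw [integral_finsetSum _ fun ε _ => hint ε, ← Finset.sum_congr rfl fun ε _ => hsigned ε]
    simp
  have hle : ∫ p, ∑ ε : Fin n → Bool,
      ⨆ i, ∑ j, rademacherSign (ε j) * (g i (p j).2 - g i (p j).1) ∂P
        ≤ ∫ _p, 2 * (2 ^ n * R) ∂P := by
    refine integral_mono_ae (integrable_finsetSum _ fun ε _ => hint ε) (integrable_const _) ?_
    filter_upwards [hsnd.quasiMeasurePreserving.ae hpos, hfst.quasiMeasurePreserving.ae hneg]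
      with p h2 h1
    rw [two_mul]
    refine le_trans ?_ (add_le_add h2 h1)
    rw [← Finset.sum_add_distrib]
    refine Finset.sum_le_sum fun ε _ => ?_
    refine le_of_eq_of_le ?_ (ciSup_add_le_add_ciSup _ _)
    refine iSup_congr fun i => ?_
    rw [← Finset.sum_add_distrib]
    exact Finset.sum_congr rfl fun j _ => by ring
  rw [← hsum, integral_const, probReal_univ, one_smul] at hle
  have h2 : (0 : ℝ) < 2 ^ n := by positivity
  nlinarith

/-! ### The ramp loss of linear classifiers -/

/-- The ramp function: `1` on `(-∞, 0]`, `0` on `[1, ∞)` and affine in between. -/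
def ramp (u : ℝ) : ℝ := max 0 (min 1 (1 - u))

theorem ramp_nonneg (u : ℝ) : 0 ≤ ramp u := le_max_left _ _

theorem ramp_le_one (u : ℝ) : ramp u ≤ 1 := max_le zero_le_one (min_le_left _ _)

theorem ramp_of_nonpos {u : ℝ} (hu : u ≤ 0) : ramp u = 1 := by
  rw [ramp, min_eq_left (by linarith), max_eq_right zero_le_one]

theorem ramp_of_one_le {u : ℝ} (hu : 1 ≤ u) : ramp u = 0 := by
  rw [ramp, max_eq_left ((min_le_right _ _).trans (by linarith))]

theorem abs_ramp_sub_le (u v : ℝ) : |ramp u - ramp v| ≤ |u - v| := by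
  unfold ramp
  refine (abs_max_sub_max_le_max _ _ _ _).trans (max_le (by simp) ?_)
  refine (abs_min_sub_min_le_max _ _ _ _).trans (max_le (by simp) (le_of_eq ?_))
  rw [abs_sub_comm]
  congr 1
  ring

theorem measurable_ramp : Measurable ramp := by unfold ramp; fun_prop

/-- The ramp loss of the linear classifier `w`: a Lipschitz function of the margin lying between the
0-1 loss and the 0-1 loss with margin `θ`. -/
noncomputable def rampLoss {d : ℕ} (θ : ℝ) (w : EuclideanSpace ℝ (Fin d)) (z : DataPoint d) : ℝ :=
  ramp ((z.2 : ℝ) * inner ℝ z.1 w / θ)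

theorem label_eq (y : Label) : (y : ℝ) = -1 ∨ (y : ℝ) = 1 := by
  exact y.2

theorem abs_label (y : Label) : |(y : ℝ)| = 1 := by
  rcases label_eq y with h | h <;> simp [h]

section

variable {d : ℕ} {θ ρ : ℝ} {a : EuclideanSpace ℝ (Fin d)}

theorem measurable_rampLoss (w : EuclideanSpace ℝ (Fin d)) : Measurable (rampLoss θ w) := by
  unfold rampLoss
  exact measurable_ramp.comp (by fun_prop)

theorem abs_rampLoss_le_one (w : EuclideanSpace ℝ (Fin d)) (z : DataPoint d) :
    |rampLoss θ w z| ≤ 1 := by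
  rw [rampLoss, abs_of_nonneg (ramp_nonneg _)]
  exact ramp_le_one _

theorem marginLoss_nonneg (z : DataPoint d) (w : EuclideanSpace ℝ (Fin d)) :
    0 ≤ marginLoss θ z w := by
  unfold marginLoss; split_ifs <;> norm_num

theorem marginLoss_le_one (z : DataPoint d) (w : EuclideanSpace ℝ (Fin d)) :
    marginLoss θ z w ≤ 1 := by
  unfold marginLoss; split_ifs <;> norm_num

theorem marginLoss_zero_le_rampLoss (hθ : 0 < θ) (z : DataPoint d)
    (w : EuclideanSpace ℝ (Fin d)) : marginLoss 0 z w ≤ rampLoss θ w z := by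
  unfold marginLoss rampLoss
  split_ifs with h
  · exact (ramp_of_nonpos (div_nonpos_of_nonpos_of_nonneg h.le hθ.le)).ge
  · exact ramp_nonneg _

theorem rampLoss_le_marginLoss (hθ : 0 < θ) (z : DataPoint d)
    (w : EuclideanSpace ℝ (Fin d)) : rampLoss θ w z ≤ marginLoss θ z w := by
  unfold marginLoss rampLoss
  split_ifs with h
  · exact ramp_le_one _
  · exact (ramp_of_one_le ((one_le_div hθ).2 (not_lt.1 h))).le

theorem abs_rampLoss_sub_le (hθ : 0 < θ) {r : ℝ} {z : DataPoint d} (hz : ‖z.1‖ ≤ r)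
    (w w' : EuclideanSpace ℝ (Fin d)) :
    |rampLoss θ w z - rampLoss θ w' z| ≤ r * ‖w - w'‖ / θ := by
  refine (abs_ramp_sub_le _ _).trans ?_
  rw [← sub_div, ← mul_sub, ← inner_sub_right, abs_div, abs_mul, abs_label, one_mul, abs_of_pos hθ]
  gcongr
  exact (abs_real_inner_le_norm _ _).trans (by gcongr)

/-- The margin with the contribution `⟪a, w⟫` of the centre clipped to `[-(ρ + θ), ρ + θ]`,
measured in units of `θ`. -/
noncomputable def clippedMargin (θ ρ : ℝ) (a w : EuclideanSpace ℝ (Fin d)) (z : DataPoint d) : ℝ :=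
  (z.2 : ℝ) * (inner ℝ (z.1 - a) w + max (-(ρ + θ)) (min (ρ + θ) (inner ℝ a w))) / θ

/-- On the ball of radius `ρ` around `a`, clipping does not change the ramp loss: where it changes
the margin, the ramp is saturated both before and after. -/
theorem rampLoss_eq_ramp_clippedMargin (hθ : 0 < θ) (hρ : 0 < ρ) {z : DataPoint d}
    (hz : ‖z.1 - a‖ ≤ ρ) {w : EuclideanSpace ℝ (Fin d)} (hw : ‖w‖ ≤ 1) :
    rampLoss θ w z = ramp (clippedMargin θ ρ a w z) := by
  have hq : |inner ℝ (z.1 - a) w| ≤ ρ :=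
    (abs_real_inner_le_norm _ _).trans
      ((mul_le_mul hz hw (norm_nonneg _) hρ.le).trans (mul_one ρ).le)
  obtain ⟨hq1, hq2⟩ := abs_le.1 hq
  have hsplit : inner ℝ z.1 w = inner ℝ (z.1 - a) w + inner ℝ a w := by
    rw [← inner_add_left, sub_add_cancel]
  unfold rampLoss clippedMargin
  rw [hsplit]
  generalize inner ℝ (z.1 - a) w = q at *
  generalize inner ℝ a w = b at *
  rcases le_total (ρ + θ) b with hb | hb
  · rw [min_eq_left hb, max_eq_right (by linarith)]
    rcases label_eq z.2 with h | h <;> rw [h]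
    · rw [ramp_of_nonpos (div_nonpos_of_nonpos_of_nonneg (by linarith) hθ.le),
        ramp_of_nonpos (div_nonpos_of_nonpos_of_nonneg (by linarith) hθ.le)]
    · rw [ramp_of_one_le ((one_le_div hθ).2 (by linarith)),
        ramp_of_one_le ((one_le_div hθ).2 (by linarith))]
  · rw [min_eq_right hb]
    rcases le_total (-(ρ + θ)) b with hb' | hb'
    · rw [max_eq_right hb']
    · rw [max_eq_left hb']
      rcases label_eq z.2 with h | h <;> rw [h]
      · rw [ramp_of_one_le ((one_le_div hθ).2 (by linarith)),
          ramp_of_one_le ((one_le_div hθ).2 (by linarith))]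
      · rw [ramp_of_nonpos (div_nonpos_of_nonpos_of_nonneg (by linarith) hθ.le),
          ramp_of_nonpos (div_nonpos_of_nonpos_of_nonneg (by linarith) hθ.le)]

/-- Rademacher complexity of the clipped margins: a linear class over a ball of radius `ρ` plus a
bounded intercept, irrespective of the size of the centre `a`. -/
theorem sum_signs_iSup_clippedMargin_le {ι : Type*} [Finite ι] [Nonempty ι] {n : ℕ}
    (hθ : 0 < θ) (hρ : 0 < ρ) (W : ι → EuclideanSpace ℝ (Fin d)) (hW : ∀ i, ‖W i‖ ≤ 1)
    (s : Fin n → DataPoint d) (hs : ∀ j, ‖(s j).1 - a‖ ≤ ρ) :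
    ∑ ε : Fin n → Bool, ⨆ i, ∑ j, rademacherSign (ε j) * clippedMargin θ ρ a (W i) (s j)
      ≤ 2 ^ n * ((2 * (ρ / θ) + 1) * Real.sqrt n) := by
  have hx := sum_signs_norm_le (fun j => ((s j).2 : ℝ) • ((s j).1 - a)) hρ.le fun j => by
    rw [norm_smul, Real.norm_eq_abs, abs_label, one_mul]; exact hs j
  have hy := sum_signs_norm_le (fun j => ((s j).2 : ℝ)) zero_le_one fun j =>
    (abs_label (s j).2).le
  calc _ ≤ ∑ ε : Fin n → Bool,
        (‖∑ j, rademacherSign (ε j) • ((s j).2 : ℝ) • ((s j).1 - a)‖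
          + (ρ + θ) * ‖∑ j, rademacherSign (ε j) • ((s j).2 : ℝ)‖) / θ := by
        refine Finset.sum_le_sum fun ε _ => ciSup_le fun i => ?_
        set b := max (-(ρ + θ)) (min (ρ + θ) (inner ℝ a (W i))) with hb
        have hb1 : |b| ≤ ρ + θ :=
          abs_le.2 ⟨le_max_left _ _, max_le (by linarith) (min_le_left _ _)⟩
        have hexp : ∑ j, rademacherSign (ε j) * clippedMargin θ ρ a (W i) (s j)
            = (inner ℝ (∑ j, rademacherSign (ε j) • ((s j).2 : ℝ) • ((s j).1 - a)) (W i)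
              + b * ∑ j, rademacherSign (ε j) • ((s j).2 : ℝ)) / θ := by
          rw [sum_inner, Finset.mul_sum, ← Finset.sum_add_distrib, Finset.sum_div]
          refine Finset.sum_congr rfl fun j _ => ?_
          rw [clippedMargin, ← hb, real_inner_smul_left, real_inner_smul_left, smul_eq_mul]
          ring
        rw [hexp]
        refine div_le_div_of_nonneg_right (add_le_add ((real_inner_le_norm _ _).trans
          (mul_le_of_le_one_right (norm_nonneg _) (hW i))) ((le_abs_self _).trans ?_)) hθ.le
        rw [abs_mul, Real.norm_eq_abs]
        gcongr
    _ = ((∑ ε : Fin n → Bool, ‖∑ j, rademacherSign (ε j) • ((s j).2 : ℝ) • ((s j).1 - a)‖)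
          + (ρ + θ) * ∑ ε : Fin n → Bool, ‖∑ j, rademacherSign (ε j) • ((s j).2 : ℝ)‖) / θ := by
        rw [← Finset.sum_div, Finset.sum_add_distrib, Finset.mul_sum]
    _ ≤ (2 ^ n * (ρ * Real.sqrt n) + (ρ + θ) * (2 ^ n * (1 * Real.sqrt n))) / θ := by
        gcongr
    _ = _ := by field_simp; ring

/-- Rademacher complexity of any class that is a contraction of the ramp losses, such as `rampLoss`
and `-rampLoss`, by comparison with the clipped margins. -/
theorem sum_signs_iSup_le_of_contraction {ι : Type*} [Finite ι] [Nonempty ι] {n : ℕ}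
    (hθ : 0 < θ) (hρ : 0 < ρ) (W : ι → EuclideanSpace ℝ (Fin d)) (hW : ∀ i, ‖W i‖ ≤ 1)
    (s : Fin n → DataPoint d) (hs : ∀ j, ‖(s j).1 - a‖ ≤ ρ) {f : ι → Fin n → ℝ}
    (hf : ∀ i i' j, |f i j - f i' j| ≤ |rampLoss θ (W i) (s j) - rampLoss θ (W i') (s j)|) :
    ∑ ε : Fin n → Bool, ⨆ i, ∑ j, rademacherSign (ε j) * f i j
      ≤ 2 ^ n * ((2 * (ρ / θ) + 1) * Real.sqrt n) := by
  refine le_trans ?_ (sum_signs_iSup_clippedMargin_le hθ hρ W hW s hs)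
  have := sum_signs_iSup_contraction (fun _ : ι => 0)
    (fun i j => clippedMargin θ ρ a (W i) (s j)) f fun i i' j => by
      refine (hf i i' j).trans ?_
      rw [rampLoss_eq_ramp_clippedMargin hθ hρ (hs j) (hW i),
        rampLoss_eq_ramp_clippedMargin hθ hρ (hs j) (hW i')]
      exact abs_ramp_sub_le _ _
  simpa only [zero_add] using this

/-! ### Uniform convergence for one client -/

/-- Uniform convergence for one client: almost surely, an integrable function of the sample with
expectation `O((ρ / θ + 1) / √n)` dominates the margin generalization error of every hypothesis.
It is the supremum of the ramp-loss deviations over a finite net of the unit ball, plus the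
resolution of that net. -/
theorem exists_uniform_bound {n : ℕ} (hn : 0 < n) (hθ : 0 < θ) (hρ : 0 < ρ)
    (μ : Measure (DataPoint d)) [IsProbabilityMeasure μ] (hμ : ∀ᵐ z ∂μ, ‖z.1 - a‖ ≤ ρ) :
    ∃ G : (Fin n → DataPoint d) → ℝ, Integrable G (Measure.pi fun _ => μ) ∧
      (∀ᵐ s ∂(Measure.pi fun _ : Fin n => μ), ∀ w, ‖w‖ ≤ 1 →
        populationRisk μ w - empiricalRisk θ s w ≤ G s) ∧
      ∫ s, G s ∂(Measure.pi fun _ => μ) ≤ 4 * (ρ / θ + 1) / Real.sqrt n := by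
  have hn' : (0 : ℝ) < n := Nat.cast_pos.2 hn
  have hsq : 0 < Real.sqrt n := Real.sqrt_pos.2 hn'
  have hr : 0 < ρ + ‖a‖ := add_pos_of_pos_of_nonneg hρ (norm_nonneg a)
  -- A net at whose scale the ramp loss varies by at most `1 / (2 * √n)`.
  set η : ℝ := θ / (2 * Real.sqrt n * (ρ + ‖a‖)) with hη
  have hη0 : 0 < η := by positivity
  obtain ⟨t, ht, htfin, hcover⟩ :=
    (isCompact_closedBall (0 : EuclideanSpace ℝ (Fin d)) 1).finite_cover_balls hη0
  have hW (i : t) : ‖(i : EuclideanSpace ℝ (Fin d))‖ ≤ 1 := by simpa using ht i.2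
  have : Finite t := htfin
  have hnet (w : EuclideanSpace ℝ (Fin d)) (hw : ‖w‖ ≤ 1) : ∃ i : t, ‖w - i‖ < η := by
    have := hcover (show w ∈ Metric.closedBall 0 1 by simpa using hw)
    simp only [Set.mem_iUnion, Metric.mem_ball, dist_eq_norm] at this
    obtain ⟨i, hi, hwi⟩ := this
    exact ⟨⟨i, hi⟩, hwi⟩
  have : Nonempty t := (hnet 0 (by simp)).nonempty
  let g (i : t) : DataPoint d → ℝ := rampLoss θ (i : EuclideanSpace ℝ (Fin d))
  have hint (w) : Integrable (rampLoss θ w) μ :=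
    Integrable.of_bound (measurable_rampLoss w).aestronglyMeasurable 1
      (Filter.Eventually.of_forall (abs_rampLoss_le_one w))
  have hs : ∀ᵐ s ∂(Measure.pi fun _ : Fin n => μ), ∀ j, ‖(s j).1 - a‖ ≤ ρ :=
    Filter.eventually_all.2 fun j =>
      (measurePreserving_eval (fun _ : Fin n => μ) j).quasiMeasurePreserving.ae hμ
  have hnorm {x : EuclideanSpace ℝ (Fin d)} (hx : ‖x - a‖ ≤ ρ) : ‖x‖ ≤ ρ + ‖a‖ := by
    have := norm_add_le (x - a) a
    rw [sub_add_cancel] at this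
    linarith
  have hclose {z : DataPoint d} (hz : ‖z.1 - a‖ ≤ ρ) {w w' : EuclideanSpace ℝ (Fin d)}
      (hw : ‖w - w'‖ < η) : |rampLoss θ w z - rampLoss θ w' z| ≤ 1 / (2 * Real.sqrt n) := by
    refine (abs_rampLoss_sub_le hθ (hnorm hz) w w').trans ?_
    calc (ρ + ‖a‖) * ‖w - w'‖ / θ ≤ (ρ + ‖a‖) * η / θ := by gcongr
      _ = 1 / (2 * Real.sqrt n) := by rw [hη]; field_simp
  have hG : Integrable (fun s : Fin n → DataPoint d => ⨆ i, ∑ j, (∫ z, g i z ∂μ - g i (s j)))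
      (Measure.pi fun _ => μ) := by
    refine integrable_iSup_of_bound (C := n * 2) (fun i => Finset.measurable_sum _ fun j _ =>
      measurable_const.sub ((measurable_rampLoss _).comp (measurable_pi_apply j))) fun i s => ?_
    refine (Finset.abs_sum_le_sum_abs _ _).trans
      ((Finset.sum_le_card_nsmul _ _ 2 fun j _ => ?_).trans (by simp))
    have h1 : |∫ z, g i z ∂μ| ≤ 1 := by
      have := norm_integral_le_of_norm_le_const (μ := μ) (f := g i) (C := 1)
        (Filter.Eventually.of_forall (abs_rampLoss_le_one _))
      simpa using this
    exact (abs_sub _ _).trans (by linarith [abs_rampLoss_le_one (θ := θ) i (s j)])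
  refine ⟨fun s => (1 / n) * (⨆ i, ∑ j, (∫ z, g i z ∂μ - g i (s j))) + 1 / Real.sqrt n,
    (hG.const_mul _).add (integrable_const _), ?_, ?_⟩
  · filter_upwards [hs] with s hs w hw
    obtain ⟨i, hi⟩ := hnet w hw
    have hpop : populationRisk μ w ≤ ∫ z, g i z ∂μ + 1 / (2 * Real.sqrt n) := by
      calc populationRisk μ w ≤ ∫ z, (g i z + 1 / (2 * Real.sqrt n)) ∂μ := by
            refine integral_mono_of_nonneg
              (Filter.Eventually.of_forall fun z => marginLoss_nonneg z w)
              ((hint _).add (integrable_const _)) ?_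
            filter_upwards [hμ] with z hz
            have h1 := marginLoss_zero_le_rampLoss hθ z w
            have h2 := (abs_le.1 (hclose hz hi)).2
            simp only [g]
            linarith
        _ = _ := by
            rw [integral_add (hint _) (integrable_const _), integral_const, probReal_univ, one_smul]
    have hemp : (1 / n) * ∑ j, g i (s j) - 1 / (2 * Real.sqrt n) ≤ empiricalRisk θ s w := by
      have h1 : ∑ j, (g i (s j) - 1 / (2 * Real.sqrt n)) ≤ ∑ j, marginLoss θ (s j) w := by
        refine Finset.sum_le_sum fun j _ => ?_
        have h1 := rampLoss_le_marginLoss hθ (s j) w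
        have h2 := (abs_le.1 (hclose (hs j) hi)).1
        simp only [g]
        linarith
      have h2 := mul_le_mul_of_nonneg_left h1 (one_div_nonneg.2 hn'.le)
      rw [Finset.sum_sub_distrib, mul_sub, Finset.sum_const, Finset.card_univ, Fintype.card_fin,
        nsmul_eq_mul, ← mul_assoc, one_div_mul_cancel hn'.ne', one_mul] at h2
      exact h2
    have hsup := le_ciSup (f := fun i => ∑ j, (∫ z, g i z ∂μ - g i (s j)))
      (Set.finite_range _).bddAbove i
    have hsup' := mul_le_mul_of_nonneg_left hsup (one_div_nonneg.2 hn'.le)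
    simp only [Finset.sum_sub_distrib, mul_sub, Finset.sum_const, Finset.card_univ,
      Fintype.card_fin, nsmul_eq_mul] at hsup'
    rw [← mul_assoc, one_div_mul_cancel hn'.ne', one_mul] at hsup'
    have hhalf : 1 / (2 * Real.sqrt n) + 1 / (2 * Real.sqrt n) = 1 / Real.sqrt n := by
      field_simp; norm_num
    simp only [Finset.sum_sub_distrib, Finset.sum_const, Finset.card_univ, Fintype.card_fin,
      nsmul_eq_mul]
    linarith
  · have hrad := integral_iSup_deviation_le_rademacher (n := n) μ g
      (fun i => measurable_rampLoss _) (fun i z => abs_rampLoss_le_one _ z)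
      (R := (2 * (ρ / θ) + 1) * Real.sqrt n)
      (hs.mono fun s hs => sum_signs_iSup_le_of_contraction hθ hρ
        (fun i : t => (i : EuclideanSpace ℝ (Fin d))) hW s hs (f := fun i j => g i (s j))
        fun i i' j => le_rfl)
      (hs.mono fun s hs => sum_signs_iSup_le_of_contraction hθ hρ
        (fun i : t => (i : EuclideanSpace ℝ (Fin d))) hW s hs (f := fun i j => -g i (s j))
        fun i i' j => by rw [neg_sub_neg, abs_sub_comm])
    rw [integral_add (hG.const_mul _) (integrable_const _), integral_const, probReal_univ, one_smul,
      integral_const_mul]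
    have hnn : (n : ℝ) = Real.sqrt n * Real.sqrt n := (Real.mul_self_sqrt hn'.le).symm
    have hfac : 1 / (n : ℝ) * (2 * ((2 * (ρ / θ) + 1) * Real.sqrt n))
        = 2 * (2 * (ρ / θ) + 1) / Real.sqrt n := by
      nth_rewrite 1 [hnn]
      field_simp
    calc _ ≤ 1 / (n : ℝ) * (2 * ((2 * (ρ / θ) + 1) * Real.sqrt n)) + 1 / Real.sqrt n := by gcongr
      _ = (4 * (ρ / θ) + 3) / Real.sqrt n := by rw [hfac, ← add_div]; ring
      _ ≤ _ := by gcongr; linarith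

/-- If all data have norm below the margin, every hypothesis has full empirical margin risk. -/
theorem risk_sub_nonpos_of_norm_lt {n : ℕ} (hn : 0 < n) (hsmall : ρ + ‖a‖ < θ)
    (μ : Measure (DataPoint d)) [IsProbabilityMeasure μ] (hμ : ∀ᵐ z ∂μ, ‖z.1 - a‖ ≤ ρ) :
    ∀ᵐ s ∂(Measure.pi fun _ : Fin n => μ), ∀ w, ‖w‖ ≤ 1 →
      populationRisk μ w - empiricalRisk θ s w ≤ 0 := by
  have hs : ∀ᵐ s ∂(Measure.pi fun _ : Fin n => μ), ∀ j, ‖(s j).1 - a‖ ≤ ρ :=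
    Filter.eventually_all.2 fun j =>
      (measurePreserving_eval (fun _ : Fin n => μ) j).quasiMeasurePreserving.ae hμ
  filter_upwards [hs] with s hs w hw
  have hpop : populationRisk μ w ≤ 1 := by
    calc populationRisk μ w ≤ ∫ _z, (1 : ℝ) ∂μ :=
          integral_mono_of_nonneg (Filter.Eventually.of_forall fun z => marginLoss_nonneg z w)
            (integrable_const _) (Filter.Eventually.of_forall fun z => marginLoss_le_one z w)
      _ = 1 := by simp
  have hemp : empiricalRisk θ s w = 1 := by
    have h1 (j : Fin n) : marginLoss θ (s j) w = 1 := by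
      refine if_pos ?_
      have hx : ‖(s j).1‖ < θ := by
        have := norm_add_le ((s j).1 - a) a
        rw [sub_add_cancel] at this
        linarith [hs j]
      refine (le_abs_self _).trans_lt ?_
      rw [abs_mul, abs_label, one_mul]
      exact (abs_real_inner_le_norm _ _).trans_lt
        ((mul_le_of_le_one_right (norm_nonneg _) hw).trans_lt hx)
    have : (n : ℝ) ≠ 0 := Nat.cast_ne_zero.2 hn.ne'
    simp [empiricalRisk, h1, this]
  linarith

/-! ### The complexity term -/

/-- The complexity term of one client, before division by the sample size. -/
noncomputable def svmComplexity (n : ℕ) (θ ρ α : ℝ) : ℝ :=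
  (ρ / θ) ^ 2 * Real.log (max 3 (θ / ρ)) * Real.log n + Real.log (max 1 (n * α / θ))

theorem sq_mul_log_nonneg (n : ℕ) (θ ρ : ℝ) :
    0 ≤ (ρ / θ) ^ 2 * Real.log (max 3 (θ / ρ)) * Real.log n :=
  mul_nonneg (mul_nonneg (sq_nonneg _) (Real.log_nonneg
    (le_trans (by norm_num) (le_max_left (3 : ℝ) _)))) (Real.log_natCast_nonneg n)

theorem svmComplexity_nonneg (n : ℕ) (θ ρ α : ℝ) : 0 ≤ svmComplexity n θ ρ α :=
  add_nonneg (sq_mul_log_nonneg n θ ρ) (Real.log_nonneg (le_max_left _ _))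

/-- Outside the trivial regime `ρ + α < θ` the complexity dominates `(ρ / θ + 1) ^ 2`. If
`ρ < θ / 4` then `n * α / θ ≥ 3 / 2`, so the logarithm of the centre is bounded below. -/
theorem add_one_sq_le_svmComplexity {n : ℕ} (hn : 2 ≤ n) {α : ℝ} (hθ : 0 < θ) (hρ : 0 < ρ)
    (h : θ ≤ ρ + α) : (ρ / θ + 1) ^ 2 ≤ 8 ^ 2 * svmComplexity n θ ρ α := by
  have hn2 : (2 : ℝ) ≤ n := by exact_mod_cast hn
  have hr : 0 < ρ / θ := div_pos hρ hθ
  rw [svmComplexity]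
  rcases le_or_gt (1 / 4) (ρ / θ) with h4 | h4
  · have hL : 1 ≤ Real.log (max 3 (θ / ρ)) := by
      rw [Real.le_log_iff_exp_le (lt_of_lt_of_le (by norm_num) (le_max_left (3 : ℝ) _))]
      exact (Real.exp_one_lt_three.le).trans (le_max_left _ _)
    have hN : 1 / 2 ≤ Real.log n :=
      (by linarith [Real.log_two_gt_d9] : (1 / 2 : ℝ) ≤ Real.log 2).trans
        (Real.log_le_log (by norm_num) hn2)
    have hlog : 0 ≤ Real.log (max 1 (n * α / θ)) := Real.log_nonneg (le_max_left _ _)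
    have h1 : (ρ / θ) ^ 2 * 1 * (1 / 2) ≤ (ρ / θ) ^ 2 * Real.log (max 3 (θ / ρ)) * Real.log n := by
      gcongr
    nlinarith
  · have hα : 3 / 4 ≤ α / θ := by
      have : 1 ≤ ρ / θ + α / θ := by rw [← add_div]; exact (one_le_div hθ).2 h
      linarith
    have h32 : 3 / 2 ≤ n * α / θ := by
      rw [mul_div_assoc]
      nlinarith
    have hlog : 1 / 3 ≤ Real.log (max 1 (n * α / θ)) := by
      have h3 := Real.one_sub_inv_le_log_of_pos (show (0 : ℝ) < 3 / 2 by norm_num)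
      have h4 := Real.log_le_log (by norm_num) (h32.trans (le_max_right 1 _))
      norm_num at h3
      linarith
    have := sq_mul_log_nonneg n θ ρ
    nlinarith

/-- The two regimes combined: an integrable bound, uniform over the hypotheses, whose expectation is
controlled by the complexity term. -/
theorem exists_uniform_bound_svmComplexity {n : ℕ} (hn : 2 ≤ n) (hθ : 0 < θ) (hρ : 0 < ρ)
    (μ : Measure (DataPoint d)) [IsProbabilityMeasure μ] (hμ : ∀ᵐ z ∂μ, ‖z.1 - a‖ ≤ ρ) :
    ∃ G : (Fin n → DataPoint d) → ℝ, Integrable G (Measure.pi fun _ => μ) ∧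
      (∀ᵐ s ∂(Measure.pi fun _ : Fin n => μ), ∀ w, ‖w‖ ≤ 1 →
        populationRisk μ w - empiricalRisk θ s w ≤ G s) ∧
      ∫ s, G s ∂(Measure.pi fun _ => μ) ≤ 32 * Real.sqrt (svmComplexity n θ ρ ‖a‖ / n) := by
  rcases lt_or_ge (ρ + ‖a‖) θ with hsmall | hlarge
  · exact ⟨fun _ => 0, integrable_const _,
      risk_sub_nonpos_of_norm_lt (by omega) hsmall μ hμ, by simp only [integral_zero]; positivity⟩
  · obtain ⟨G, hG, hle, hint⟩ := exists_uniform_bound (n := n) (by omega) hθ hρ μ hμ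
    refine ⟨G, hG, hle, hint.trans ?_⟩
    have h : ρ / θ + 1 ≤ 8 * Real.sqrt (svmComplexity n θ ρ ‖a‖) := by
      refine abs_le_of_sq_le_sq' ?_ (by positivity) |>.2
      rw [mul_pow, Real.sq_sqrt (svmComplexity_nonneg _ _ _ _)]
      exact add_one_sq_le_svmComplexity hn hθ hρ hlarge
    rw [Real.sqrt_div (svmComplexity_nonneg _ _ _ _), ← mul_div_assoc]
    refine div_le_div_of_nonneg_right ?_ (Real.sqrt_nonneg _)
    linarith

end

/-! ### Aggregation over the clients -/

theorem norm_aggregate_le_one {K d : ℕ} (hK : 0 < K) (w : Fin K → Hypothesis d) :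
    ‖aggregate w‖ ≤ 1 := by
  have hK' : (0 : ℝ) < K := Nat.cast_pos.2 hK
  rw [aggregate, norm_smul, Real.norm_of_nonneg (one_div_nonneg.2 hK'.le)]
  have h : ‖∑ k, (w k : EuclideanSpace ℝ (Fin d))‖ ≤ K := by
    refine (norm_sum_le _ _).trans ((Finset.sum_le_card_nsmul _ _ 1 fun k _ => ?_).trans (by simp))
    exact mem_closedBall_zero_iff.1 (w k).2
  calc 1 / (K : ℝ) * _ ≤ 1 / (K : ℝ) * K := by gcongr
    _ = 1 := one_div_mul_cancel hK'.ne'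

theorem measurePreserving_sample_clientLaw {d n : ℕ} (μ : Measure (DataPoint d))
    [IsProbabilityMeasure μ] (A : Kernel (Fin n → DataPoint d) (Hypothesis d))
    [IsMarkovKernel A] :
    MeasurePreserving Prod.fst (clientLaw μ A) (Measure.pi fun _ => μ) :=
  ⟨measurable_fst, Measure.fst_compProd _ _⟩

theorem measurePreserving_sample_systemLaw {K d n : ℕ} (μ : Fin K → Measure (DataPoint d))
    (hμ : ∀ k, IsProbabilityMeasure (μ k))
    (A : Fin K → Kernel (Fin n → DataPoint d) (Hypothesis d)) (hA : ∀ k, IsMarkovKernel (A k))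
    (k : Fin K) :
    MeasurePreserving (fun ω : Fin K → (Fin n → DataPoint d) × Hypothesis d => (ω k).1)
      (systemLaw μ A) (Measure.pi fun _ => μ k) := by
  have (k : Fin K) : IsProbabilityMeasure (clientLaw (μ k) (A k)) := by
    unfold clientLaw; infer_instance
  exact (measurePreserving_sample_clientLaw (μ k) (A k)).comp
    (measurePreserving_eval (fun k => clientLaw (μ k) (A k)) k)

theorem measurable_marginLoss {d : ℕ} (θ : ℝ) :
    Measurable fun q : DataPoint d × EuclideanSpace ℝ (Fin d) => marginLoss θ q.1 q.2 := by
  unfold marginLoss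
  refine Measurable.ite (measurableSet_lt ?_ measurable_const) measurable_const measurable_const
  fun_prop

/-- The generalization error is a bounded measurable function of the data sets and the models. -/
theorem integrable_marginGen_systemLaw {K d n : ℕ} (θ : ℝ)
    (μ : Fin K → Measure (DataPoint d)) (hμ : ∀ k, IsProbabilityMeasure (μ k))
    (A : Fin K → Kernel (Fin n → DataPoint d) (Hypothesis d)) (hA : ∀ k, IsMarkovKernel (A k)) :
    Integrable (fun ω : Fin K → (Fin n → DataPoint d) × Hypothesis d =>
      marginGen θ μ (fun k => (ω k).1) (aggregate fun k => (ω k).2)) (systemLaw μ A) := by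
  have hprob (k : Fin K) : IsProbabilityMeasure (clientLaw (μ k) (A k)) := by
    unfold clientLaw; infer_instance
  have hsys : IsProbabilityMeasure (systemLaw μ A) := by unfold systemLaw; infer_instance
  have hagg : Measurable fun ω : Fin K → (Fin n → DataPoint d) × Hypothesis d =>
      aggregate fun k => (ω k).2 := by
    unfold aggregate
    exact (Finset.measurable_sum _ fun k _ => measurable_subtype_coe.comp
      (measurable_snd.comp (measurable_pi_apply k))).const_smul (1 / (K : ℝ))
  refine (integrable_finsetSum _ fun k _ => Integrable.sub ?_ ?_).const_mul _
  · have hpop : Measurable (populationRisk (μ k)) :=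
      (StronglyMeasurable.integral_prod_right (ν := μ k) (f := fun w z => marginLoss 0 z w)
        ((measurable_marginLoss 0).comp measurable_swap).stronglyMeasurable).measurable
    refine Integrable.of_bound (hpop.comp hagg).aestronglyMeasurable 1
      (Filter.Eventually.of_forall fun ω => ?_)
    have := norm_integral_le_of_norm_le_const (μ := μ k) (C := 1)
      (f := fun z => marginLoss 0 z (aggregate fun k => (ω k).2))
      (Filter.Eventually.of_forall fun z => by
        rw [Real.norm_of_nonneg (marginLoss_nonneg _ _)]; exact marginLoss_le_one _ _)
    simpa [populationRisk] using this
  · refine (integrable_finsetSum _ fun i _ => Integrable.of_bound ?_ 1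
      (Filter.Eventually.of_forall fun ω => ?_)).const_mul _
    · exact ((measurable_marginLoss θ).comp (Measurable.prodMk ((measurable_pi_apply i).comp
        (measurable_fst.comp (measurable_pi_apply k))) hagg)).aestronglyMeasurable
    · rw [Real.norm_of_nonneg (marginLoss_nonneg _ _)]
      exact marginLoss_le_one _ _

/-- Bounds that are uniform over the hypotheses control the expected generalization error of the
aggregated model, for whatever learning algorithms. -/
theorem expectedMarginGen_le_of_uniform_bound {K d n : ℕ} (hK : 0 < K) {θ : ℝ}
    (μ : Fin K → Measure (DataPoint d)) (hμ : ∀ k, IsProbabilityMeasure (μ k))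
    (A : Fin K → Kernel (Fin n → DataPoint d) (Hypothesis d)) (hA : ∀ k, IsMarkovKernel (A k))
    {B : Fin K → ℝ}
    (hB : ∀ k, ∃ G : (Fin n → DataPoint d) → ℝ, Integrable G (Measure.pi fun _ => μ k) ∧
      (∀ᵐ s ∂(Measure.pi fun _ : Fin n => μ k), ∀ w, ‖w‖ ≤ 1 →
        populationRisk (μ k) w - empiricalRisk θ s w ≤ G s) ∧
      ∫ s, G s ∂(Measure.pi fun _ => μ k) ≤ B k) :
    expectedMarginGen θ μ A ≤ (1 / (K : ℝ)) * ∑ k, B k := by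
  choose G hG hle hint using hB
  have hK' : (0 : ℝ) ≤ 1 / K := one_div_nonneg.2 (Nat.cast_nonneg K)
  have hS := measurePreserving_sample_systemLaw μ hμ A hA
  have hGS (k) : Integrable (fun ω : Fin K → (Fin n → DataPoint d) × Hypothesis d =>
      G k (ω k).1) (systemLaw μ A) := (hS k).integrable_comp_of_integrable (hG k)
  have hprob (k : Fin K) : IsProbabilityMeasure (clientLaw (μ k) (A k)) := by
    unfold clientLaw; infer_instance
  have hsys : IsProbabilityMeasure (systemLaw μ A) := by unfold systemLaw; infer_instance
  have hexp : ∫ ω, (1 / (K : ℝ)) * ∑ k, G k (ω k).1 ∂(systemLaw μ A)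
      = (1 / (K : ℝ)) * ∑ k, ∫ s, G k s ∂(Measure.pi fun _ => μ k) := by
    rw [integral_const_mul, integral_finsetSum _ fun k _ => hGS k]
    congr 1
    refine Finset.sum_congr rfl fun k _ => ?_
    rw [← (hS k).map_eq, integral_map (hS k).measurable.aemeasurable]
    rw [(hS k).map_eq]
    exact (hG k).aestronglyMeasurable
  calc expectedMarginGen θ μ A ≤ ∫ ω, (1 / (K : ℝ)) * ∑ k, G k (ω k).1 ∂(systemLaw μ A) := by
        refine integral_mono_ae (integrable_marginGen_systemLaw θ μ hμ A hA)
          ((integrable_finsetSum _ fun k _ => hGS k).const_mul _) ?_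
        have hall := Filter.eventually_all.2 fun k => (hS k).quasiMeasurePreserving.ae (hle k)
        filter_upwards [hall] with ω hω
        exact mul_le_mul_of_nonneg_left
          (Finset.sum_le_sum fun k _ => hω k _ (norm_aggregate_le_one hK _)) hK'
    _ ≤ _ := by
        rw [hexp]
        exact mul_le_mul_of_nonneg_left (Finset.sum_le_sum fun k _ => hint k) hK'

theorem isProbabilityMeasure_equalMixture {d : ℕ} (μ : Fin 2 → Measure (DataPoint d))
    (hμ : ∀ k, IsProbabilityMeasure (μ k)) : IsProbabilityMeasure (equalMixture μ) := by
  refine ⟨?_⟩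
  rw [equalMixture, Measure.smul_apply, Measure.add_apply, measure_univ, measure_univ,
    one_add_one_eq_two, smul_eq_mul, ENNReal.inv_mul_cancel (by norm_num) (by norm_num)]

theorem ae_equalMixture {d : ℕ} {μ : Fin 2 → Measure (DataPoint d)} {p : DataPoint d → Prop}
    (h : ∀ k, ∀ᵐ z ∂(μ k), p z) : ∀ᵐ z ∂(equalMixture μ), p z :=
  Measure.ae_smul_measure (ae_add_measure_iff.2 ⟨h 0, h 1⟩) _

/-- Concavity of the square root, for two points. -/
theorem sqrt_add_sqrt_le {x y : ℝ} (hx : 0 ≤ x) (hy : 0 ≤ y) :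
    1 / 2 * (Real.sqrt x + Real.sqrt y) ≤ Real.sqrt ((x + y) / 2) := by
  refine Real.le_sqrt_of_sq_le ?_
  nlinarith [sq_nonneg (Real.sqrt x - Real.sqrt y), Real.sq_sqrt hx, Real.sq_sqrt hy]

theorem theorem7 :
    ∃ C : ℝ, 0 < C ∧
      ∀ (d n : ℕ), 2 ≤ n →
      ∀ (θ ρ : ℝ), 0 < θ → θ ≤ 1 → 0 < ρ →
      ∀ (a : Fin 2 → EuclideanSpace ℝ (Fin d)) (μ : Fin 2 → Measure (DataPoint d)),
        (∀ k, IsProbabilityMeasure (μ k)) →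
        (∀ k, ∀ᵐ z ∂(μ k), ‖z.1 - a k‖ ≤ ρ) →
      ∀ (A : Fin 2 → Kernel (Fin n → DataPoint d) (Hypothesis d)),
        (∀ k, IsMarkovKernel (A k)) →
        -- heterogeneous setting: client `k` samples from `μ k`
        expectedMarginGen θ μ A ≤
          C * Real.sqrt
            (((ρ / θ) ^ 2 * Real.log (max 3 (θ / ρ)) * Real.log n
              + 1 / 2 * (Real.log (max 1 (n * ‖a 0‖ / θ))
                + Real.log (max 1 (n * ‖a 1‖ / θ)))) / n) ∧
        -- homogeneous setting: both clients sample from the equal mixture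
        expectedMarginGen θ (fun _ => equalMixture μ) A ≤
          C * Real.sqrt
            (1 / n *
              (((ρ + ‖a 0 - a 1‖) / θ) ^ 2
                  * Real.log (max 3 (θ / (ρ + ‖a 0 - a 1‖))) * Real.log n
                + Real.log (max 1 (n * ‖a 0 + a 1‖ / θ)))) := by
  refine ⟨32, by norm_num, fun d n hn θ ρ hθ _ hρ a μ hμ ha A hA => ⟨?_, ?_⟩⟩
  · refine (expectedMarginGen_le_of_uniform_bound two_pos μ hμ A hA fun k =>
      have := hμ k
      exists_uniform_bound_svmComplexity hn hθ hρ (μ k) (ha k)).trans ?_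
    rw [Fin.sum_univ_two]
    have hx (k) : 0 ≤ svmComplexity n θ ρ ‖a k‖ / n :=
      div_nonneg (svmComplexity_nonneg _ _ _ _) (Nat.cast_nonneg n)
    have h := mul_le_mul_of_nonneg_left (sqrt_add_sqrt_le (hx 0) (hx 1))
      (show (0 : ℝ) ≤ 32 by norm_num)
    refine le_of_eq_of_le ?_ (h.trans (le_of_eq ?_))
    · push_cast; ring
    · congr 2
      unfold svmComplexity
      ring
  · have hp := isProbabilityMeasure_equalMixture μ hμ
    have hcentre : ∀ᵐ z ∂(equalMixture μ),
        ‖z.1 - (1 / 2 : ℝ) • (a 0 + a 1)‖ ≤ ρ + ‖a 0 - a 1‖ := by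
      refine ae_equalMixture fun k => (ha k).mono fun z hz => ?_
      have hdist : ‖a k - (1 / 2 : ℝ) • (a 0 + a 1)‖ ≤ ‖a 0 - a 1‖ := by
        have h0 : a 0 - (1 / 2 : ℝ) • (a 0 + a 1) = (1 / 2 : ℝ) • (a 0 - a 1) := by module
        have h1 : a 1 - (1 / 2 : ℝ) • (a 0 + a 1) = -((1 / 2 : ℝ) • (a 0 - a 1)) := by module
        have hn0 := norm_nonneg (a 0 - a 1)
        fin_cases k
        · simp only [Fin.zero_eta, h0, norm_smul]; norm_num; linarith
        · simp only [Fin.mk_one, h1, norm_neg, norm_smul]; norm_num; linarith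
      exact (norm_sub_le_norm_sub_add_norm_sub z.1 (a k) _).trans (add_le_add hz hdist)
    have hρ' : 0 < ρ + ‖a 0 - a 1‖ := add_pos_of_pos_of_nonneg hρ (norm_nonneg _)
    refine (expectedMarginGen_le_of_uniform_bound two_pos _ (fun _ => hp) A hA fun _ =>
      exists_uniform_bound_svmComplexity hn hθ hρ' (equalMixture μ) hcentre).trans ?_
    rw [Fin.sum_univ_two, ← two_mul, ← mul_assoc]
    norm_num only [one_div_mul_cancel, Nat.cast_ofNat, one_mul]
    rw [one_div_mul_eq_div]
    unfold svmComplexity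
    gcongr
    rw [norm_smul]
    norm_num
    linarith [norm_nonneg (a 0 + a 1)]
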